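/- Work in ZFC, and let $V$ be the universe of sets. Conventions: * A formula of set theory is $\Sigma_1$ if it is a block of existential quantifiers followed by a $\Delta_0$ formula (all quantifiers bounded). For a set or class $P$, a class $\mathcal C$ is $\Sigma_1$-definable with parameters in $P$ if $\mathcal C=\{x:\varphi(x,p_1,\dots,p_n)\}$ for some $\Sigma_1$ formula $\varphi$ and some $p_1,\dots,p_n\in P$. A proper class is a class that is not a set. * $C^{(1)}$ is the class of all ordinals $\kappa$ with $V_\kappa\preceq_{\Sigma_1}V$, that is, every $\Sigma_1$ formula with parameters in $V_\kappa$ holds in $V_\kappa$ if and only if it holds in $V$. * A graph is a pair $\langle G,E\rangle$ with $G$ a non-empty set and $E\subseteq G\times G$. More generally, a relational language $\tau$ (possibly many-sorted and infinitary) consists of a set of sorts and a function that assigns to each relation symbol $R$ of a set of symbols a sequence of sorts whose length is an ordinal, possibly infinite, the arity of $R$. A $\tau$-structure assigns to every sort a set (the universe of that sort) and to every symbol $R$ a set of sequences of the length and sorts prescribed by $\tau$. Homomorphisms are maps (one for each sort) that preserve all relations. * For a set $S$ of graphs, or of $\tau$-structures, $\prod S$ is the structure whose universe (of each sort) is the set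 of all functions $f$ with domain $S$ such that $f(\mathcal A)$ is in the universe of $\mathcal A$ (of that sort) for every $\mathcal A\in S$, and whose relations are defined pointwise. * A set $S$ witnesses $\mathrm{PRP}$ for a class $\mathcal C$ if $S\subseteq\mathcal C$ and for every $\mathcal A\in\mathcal C$ there is a homomorphism $\prod S\to\mathcal A$. For a set or class $P$, $\Sigma_1(P)$-$\mathrm{PRP}$ asserts that for every proper class $\mathcal C$ of graphs that is $\Sigma_1$-definable with parameters in $P$ there is a set that witnesses $\mathrm{PRP}$ for $\mathcal C$; and $\mathbf{\Sigma_1}$-$\mathrm{PRP}$ is $\Sigma_1(V)$-$\mathrm{PRP}$. **Proposition.** $\mathbf{\Sigma_1}$-$\mathrm{PRP}$ holds. In fact, let $\kappa\in C^{(1)}$. Then for every proper class $\mathcal C$ of graphs that is $\Sigma_1$-definable with parameters in $V_\kappa$, the set $\mathcal C\cap V_\kappa$ witnesses $\mathrm{PRP}$ for $\mathcal C$. More generally, for every relational language $\tau\in V_\kappa$ and every proper class $\mathcal C$ of $\tau$-structures that is $\Sigma_1$-definable with parameters in $V_\kappa$, the set $\mathcal C\cap V_\kappa$ witnesses $\mathrm{PRP}$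 for $\mathcal C$. -/

import Mathlib

universe u v w

namespace PRP

noncomputable section

open FirstOrder

/-! ### The language of set theory and the first level of the Lévy hierarchy

The universe `V` of sets is Mathlib's `ZFSet`; classes are sets of type `Set ZFSet`. -/

/-- The relation symbols of the language of set theory: one binary symbol. -/
inductive SetRel : ℕ → Type
  | mem : SetRel 2

/-- The first-order language `{∈}` of set theory. -/
def setLang : Language := ⟨fun _ => Empty, SetRel⟩

/-- The standard interpretation of `∈` in the universe `V`. -/
instance : setLang.Structure ZFSet.{u} where
  funMap := fun f => nomatch f
  RelMap := fun {_} r xs => match r with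
    | .mem => xs 0 ∈ xs 1

/-- The `∈`-structure `(M, ∈)` on a class `M = {x | P x}`, in particular on a set. -/
instance (P : ZFSet.{u} → Prop) : setLang.Structure {x : ZFSet.{u} // P x} where
  funMap := fun f => nomatch f
  RelMap := fun {_} r xs => match r with
    | .mem => (xs 0).1 ∈ (xs 1).1

/-- The atomic formula `s ∈ t`. -/
def memF {α : Type w} {n : ℕ} (s t : setLang.Term (α ⊕ Fin n)) : setLang.BoundedFormula α n :=
  Language.Relations.boundedFormula₂ (L := setLang) SetRel.mem s t

/-- The bounded universal quantification `∀ x ∈ y, φ`, where `y` is any variable in scope other than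
the quantified variable `x`. -/
def ballF {α : Type w} {n : ℕ} (y : α ⊕ Fin n) (φ : setLang.BoundedFormula α (n + 1)) :
    setLang.BoundedFormula α n :=
  ((memF (Language.Term.var (Sum.inr (Fin.last n)))
    (Language.Term.var (Sum.map id Fin.castSucc y))).imp φ).all

/-- `Δ₀` formulas: generated from atomic formulas by propositional connectives and bounded
quantification. (The other connectives and `∃ x ∈ y` are abbreviations in terms of `⊥`, `→` and
`∀ x ∈ y`.) -/
inductive IsDeltaZero {α : Type w} : ∀ {n : ℕ}, setLang.BoundedFormula α n → Prop
  | falsum {n : ℕ} : IsDeltaZero (Language.BoundedFormula.falsum : setLang.BoundedFormula α n)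
  | equal {n : ℕ} (s t : setLang.Term (α ⊕ Fin n)) :
      IsDeltaZero (Language.BoundedFormula.equal s t)
  | mem {n : ℕ} (s t : setLang.Term (α ⊕ Fin n)) : IsDeltaZero (memF s t)
  | imp {n : ℕ} {φ ψ : setLang.BoundedFormula α n} :
      IsDeltaZero φ → IsDeltaZero ψ → IsDeltaZero (φ.imp ψ)
  | ball {n : ℕ} (y : α ⊕ Fin n) {φ : setLang.BoundedFormula α (n + 1)} :
      IsDeltaZero φ → IsDeltaZero (ballF y φ)

/-- `Σ₁` formulas: a block of existential quantifiers followed by a `Δ₀` formula. -/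
inductive IsSigmaOne {α : Type w} : ∀ {n : ℕ}, setLang.BoundedFormula α n → Prop
  | deltaZero {n : ℕ} {φ : setLang.BoundedFormula α n} : IsDeltaZero φ → IsSigmaOne φ
  | ex {n : ℕ} {φ : setLang.BoundedFormula α (n + 1)} : IsSigmaOne φ → IsSigmaOne φ.ex

/-- The class `C` is `Σ₁`-definable with parameters in `P`: for some `Σ₁` formula `φ` and some
parameters `p₁, …, pₙ ∈ P`, `C = {x | V ⊨ φ(x, p₁, …, pₙ)}`. -/
def SigmaOneDefinable (P : Set ZFSet.{u}) (C : Set ZFSet.{u}) : Prop :=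
  ∃ (n : ℕ) (φ : setLang.Formula (Fin (n + 1))) (p : Fin n → ZFSet.{u}),
    IsSigmaOne φ ∧ (∀ i, p i ∈ P) ∧
      ∀ x : ZFSet.{u}, x ∈ C ↔ φ.Realize (Fin.cons x p : Fin (n + 1) → ZFSet.{u})

/-- `κ ∈ C⁽¹⁾`: the ordinal `κ` is `Σ₁`-correct in `V`, i.e. `V_κ ≼_{Σ₁} V`. -/
def SigmaOneCorrect (κ : Ordinal.{u}) : Prop :=
  ∀ (n : ℕ) (φ : setLang.Formula (Fin n)), IsSigmaOne φ →
    ∀ a : Fin n → {x : ZFSet.{u} // x ∈ ZFSet.vonNeumann κ},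
      φ.Realize a ↔ φ.Realize fun i => (a i : ZFSet.{u})

/-- A proper class: a class that is not a set. -/
def IsProperClass (C : Set ZFSet.{u}) : Prop :=
  ¬ ∃ s : ZFSet.{u}, ∀ x : ZFSet.{u}, x ∈ C ↔ x ∈ s

/-- The set `C ∩ V_κ`. -/
def cut (C : Set ZFSet.{u}) (κ : Ordinal.{u}) : ZFSet.{u} :=
  ZFSet.sep (fun x => x ∈ C) (ZFSet.vonNeumann κ)

/-! ### Graphs -/

/-- A graph `⟨G, E⟩`: a nonempty set `G` with a binary relation `E ⊆ G × G`. -/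
structure Graph where
  /-- the set of vertices -/
  G : ZFSet.{u}
  /-- the edge relation -/
  E : ZFSet.{u}
  nonempty : G.Nonempty
  subset : E ⊆ G.prod G

/-- The set (ordered pair) `⟨G, E⟩`. -/
def Graph.code (A : Graph.{u}) : ZFSet.{u} := ZFSet.pair A.G A.E

/-- The binary relation of a graph, on the type of its vertices. -/
def Graph.Rel (A : Graph.{u}) (x y : {x : ZFSet.{u} // x ∈ A.G}) : Prop :=
  ZFSet.pair x.1 y.1 ∈ A.E

/-- The members of the set `S` that are graphs. -/
abbrev GraphIn (S : ZFSet.{u}) := {A : Graph.{u} // A.code ∈ S}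

/-- The relation of the product `∏ S` of a set `S` of graphs. The universe of the product consists of
all functions `f` with domain `S` such that `f A` is a vertex of `A`; the relation is defined
pointwise. -/
def GraphProdRel (S : ZFSet.{u})
    (f g : (A : GraphIn S) → {x : ZFSet.{u} // x ∈ A.1.G}) : Prop :=
  ∀ A : GraphIn S, A.1.Rel (f A) (g A)

/-- `C` is a class of graphs. -/
def IsGraphClass (C : Set ZFSet.{u}) : Prop := ∀ x ∈ C, ∃ A : Graph.{u}, A.code = x

/-- The set `S` witnesses the product reflection principle for the class `C` of graphs: `S ⊆ C`, and
for every `A` in `C` there is a homomorphism `∏ S → A`. -/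
def GraphWitness (C : Set ZFSet.{u}) (S : ZFSet.{u}) : Prop :=
  (∀ x ∈ S, x ∈ C) ∧
    ∀ A : Graph.{u}, A.code ∈ C → Nonempty (GraphProdRel S →r A.Rel)

/-- `Σ₁(P)-PRP`. -/
def SigmaOnePRP (P : Set ZFSet.{u}) : Prop :=
  ∀ C : Set ZFSet.{u}, SigmaOneDefinable P C → IsProperClass C → IsGraphClass C →
    ∃ S : ZFSet.{u}, GraphWitness C S

/-- Boldface `Σ₁-PRP`: any set is allowed as a parameter. -/
def BoldfaceSigmaOnePRP : Prop := SigmaOnePRP.{u} Set.univ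

/-! ### Functions, as sets of ordered pairs -/

/-- `f` is a function, i.e. a single-valued set of ordered pairs. -/
def IsFunction (f : ZFSet.{u}) : Prop :=
  (∀ p ∈ f, ∃ a b, p = ZFSet.pair a b) ∧
    ∀ a b c, ZFSet.pair a b ∈ f → ZFSet.pair a c ∈ f → b = c

/-- The domain of `f`. -/
def dom (f : ZFSet.{u}) : ZFSet.{u} :=
  ZFSet.sep (fun a => ∃ b, ZFSet.pair a b ∈ f) (ZFSet.sUnion (ZFSet.sUnion f))

open Classical in
/-- The value `f(a)` of the function `f` at `a ∈ dom f`. -/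
def app (f a : ZFSet.{u}) : ZFSet.{u} :=
  if h : ∃ b, ZFSet.pair a b ∈ f then h.choose else ∅

/-- `dom f` is the domain of `f`. -/
theorem mem_dom {f a : ZFSet.{u}} : a ∈ dom f ↔ ∃ b, ZFSet.pair a b ∈ f := by
  constructor
  · intro h
    exact (ZFSet.mem_sep.1 h).2
  · rintro ⟨b, hb⟩
    refine ZFSet.mem_sep.2 ⟨?_, b, hb⟩
    refine ZFSet.mem_sUnion.2 ⟨{a}, ZFSet.mem_sUnion.2 ⟨_, hb, ?_⟩, by simp⟩
    simp [ZFSet.pair]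

/-- The function with domain `n` that takes the value `t i` at `i`. -/
def tuple {n : ZFSet.{u}} (t : {i : ZFSet.{u} // i ∈ n} → ZFSet.{u}) : ZFSet.{u} :=
  ZFSet.range fun i : {i : ZFSet.{u} // i ∈ n} => ZFSet.pair i.1 (t i)

/-! ### Many-sorted infinitary relational languages and their structures -/

/-- A (possibly many-sorted, possibly infinitary) relational language. It is given by a set `sorts`
of sorts and a function `type`, whose domain is the set of relation symbols, and which assigns to
every relation symbol `R` a sequence of sorts; the length of that sequence is an ordinal, the arity
of `R`. A one-sorted language is one in which `sorts` is a singleton. -/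
structure RelLang where
  /-- the set of sorts -/
  sorts : ZFSet.{u}
  /-- the function that assigns to a symbol the sequence of the sorts of its arguments -/
  type : ZFSet.{u}
  isFunction_type : IsFunction type
  isFunction_app : ∀ R ∈ dom type, IsFunction (app type R)
  isOrdinal_arity : ∀ R ∈ dom type, (dom (app type R)).IsOrdinal
  sort_mem : ∀ R ∈ dom type, ∀ i ∈ dom (app type R), app (app type R) i ∈ sorts

namespace RelLang

/-- The language as a set. -/
def code (τ : RelLang.{u}) : ZFSet.{u} := ZFSet.pair τ.sorts τ.type

/-- The sorts of `τ`. -/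
abbrev Sorts (τ : RelLang.{u}) := {s : ZFSet.{u} // s ∈ τ.sorts}

/-- The relation symbols of `τ`. -/
abbrev Symbols (τ : RelLang.{u}) := {R : ZFSet.{u} // R ∈ dom τ.type}

/-- The argument places of the symbol `R`, i.e. the ordinals below the arity of `R`. -/
abbrev Places (τ : RelLang.{u}) (R : τ.Symbols) :=
  {i : ZFSet.{u} // i ∈ dom (app τ.type R.1)}

/-- The sort of the `i`-th argument of the symbol `R`. -/
def sortAt (τ : RelLang.{u}) (R : τ.Symbols) (i : τ.Places R) : τ.Sorts :=
  ⟨app (app τ.type R.1) i.1, τ.sort_mem R.1 R.2 i.1 i.2⟩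

end RelLang

/-- A structure of the language `τ` in the sense of model theory: a universe for every sort and a
relation for every relation symbol. -/
structure Model (τ : RelLang.{u}) where
  /-- the universe of sort `s` -/
  carrier : τ.Sorts → Type v
  /-- the interpretation of the symbol `R` -/
  rel : (R : τ.Symbols) → ((i : τ.Places R) → carrier (τ.sortAt R i)) → Prop

/-- A homomorphism: a map for every sort, such that all relations are preserved. -/
structure Model.Hom {τ : RelLang.{u}} (M : Model.{u, v} τ) (N : Model.{u, w} τ) where
  /-- the maps between the universes -/
  toFun : (s : τ.Sorts) → M.carrier s → N.carrier s
  map_rel : ∀ (R : τ.Symbols) (t : (i : τ.Places R) → M.carrier (τ.sortAt R i)),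
    M.rel R t → N.rel R fun i => toFun _ (t i)

/-- The product of a family of structures, with universes the sets of all choice functions and with
the relations defined pointwise. -/
def Model.prod {τ : RelLang.{u}} {ι : Type w} (M : ι → Model.{u, v} τ) :
    Model.{u, max v w} τ where
  carrier := fun s => (j : ι) → (M j).carrier s
  rel := fun R t => ∀ j : ι, (M j).rel R fun i => t i j

/-- A structure of the language `τ` as an object of set theory: a function `univ` that assigns to
every sort a set, and a function `rel` that assigns to every relation symbol `R` a set of sequences
of the length and of the sorts that `R` demands. -/
structure Str (τ : RelLang.{u}) where
  /-- the function that assigns to a sort its universe -/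
  univ : ZFSet.{u}
  /-- the function that assigns to a symbol its interpretation -/
  rel : ZFSet.{u}
  isFunction_univ : IsFunction univ
  dom_univ : dom univ = τ.sorts
  isFunction_rel : IsFunction rel
  dom_rel : dom rel = dom τ.type
  isFunction_of_mem : ∀ R ∈ dom τ.type, ∀ t ∈ app rel R,
    IsFunction t ∧ dom t = dom (app τ.type R) ∧
      ∀ i ∈ dom t, app t i ∈ app univ (app (app τ.type R) i)

namespace Str

variable {τ : RelLang.{u}}

/-- The set (ordered pair) `⟨univ, rel⟩`. -/
def code (A : Str τ) : ZFSet.{u} := ZFSet.pair A.univ A.rel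

/-- The model-theoretic structure described by the set `A`. -/
def model (A : Str τ) : Model.{u, u + 1} τ where
  carrier := fun s => {x : ZFSet.{u} // x ∈ app A.univ s.1}
  rel := fun R t => tuple (fun i : τ.Places R => (t i).1) ∈ app A.rel R.1

end Str

/-- The product `∏ S` of a set `S` of structures of the language `τ`: for every sort, the universe
consists of all functions `f` with domain `S` such that `f A` belongs to the universe of `A`. -/
def strProd (τ : RelLang.{u}) (S : ZFSet.{u}) : Model.{u, u + 1} τ :=
  Model.prod fun A : {A : Str τ // A.code ∈ S} => A.1.model

/-- `C` is a class of structures of the language `τ`. -/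
def IsStrClass (τ : RelLang.{u}) (C : Set ZFSet.{u}) : Prop := ∀ x ∈ C, ∃ A : Str τ, A.code = x

/-- The set `S` witnesses the product reflection principle for the class `C` of structures of the
language `τ`: `S ⊆ C`, and for every `A` in `C` there is a homomorphism `∏ S → A`. -/
def StrWitness (τ : RelLang.{u}) (C : Set ZFSet.{u}) (S : ZFSet.{u}) : Prop :=
  (∀ x ∈ S, x ∈ C) ∧
    ∀ A : Str τ, A.code ∈ C → Nonempty ((strProd τ S).Hom A.model)

end

end PRP

namespace PRP

noncomputable section

open FirstOrder

/-! ### Δ₀ formulas: absoluteness and definability -/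

/-! Given a structure `A` in `C`, choose `α < κ` above the parameters (and the language) and take `N
≺ V` containing `A`, with `V_α ⊆ N` and `|N| = |V_α|`. Let `B` be the image of `A` under the
Mostowski collapse of `N`. The collapse fixes `V_α` and has transitive range, so upward absoluteness
of Σ₁ formulas gives `B ∈ C`. The inverse `j` of the collapse preserves `∈` and pairs and sends `B`
to `A`, so it restricts to a homomorphism `B → A`; composed with the projection to the factor `B`,
it maps the product to `A`.

What remains is `B ∈ V_κ`, which is where Σ₁-correctness enters (`SigmaOneCorrect.collapse_mem`):
`N` is isomorphic to a relation on `V_α` lying in `V_κ`, the existence of its collapse is a Σ₁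
statement, and the collapse is unique. `SigmaOneDefinable.exists_reflection` packages the
construction. The boldface principle also needs Σ₁-correct ordinals above any given rank
(`exists_sigmaOneCorrect`). -/

/-- A class is closed under taking members. -/
def IsTransitiveClass (P : ZFSet.{u} → Prop) : Prop := ∀ x, P x → ∀ y ∈ x, P y

theorem term_eq_var {α : Type w} (t : setLang.Term α) : ∃ i, t = Language.Term.var i := by
  cases t with
  | var i => exact ⟨i, rfl⟩
  | func f _ => exact nomatch f

section Realize

variable {α : Type w} {n : ℕ}

theorem realize_memF (x y : α ⊕ Fin n) (v : α → ZFSet.{u}) (xs : Fin n → ZFSet.{u}) :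
    (memF (Language.Term.var x) (Language.Term.var y)).Realize v xs ↔
      Sum.elim v xs x ∈ Sum.elim v xs y :=
  Iff.rfl

theorem realize_memF_subtype {P : ZFSet.{u} → Prop} (x y : α ⊕ Fin n) (v : α → {x // P x})
    (xs : Fin n → {x // P x}) :
    (memF (Language.Term.var x) (Language.Term.var y)).Realize v xs ↔
      (Sum.elim v xs x).1 ∈ (Sum.elim v xs y).1 :=
  Iff.rfl

theorem elim_snoc_lift {M : Type*} (v : α → M) (xs : Fin n → M) (z : M) (y : α ⊕ Fin n) :
    Sum.elim v (Fin.snoc xs z : Fin (n + 1) → M) (Sum.map id Fin.castSucc y) =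
      Sum.elim v xs y := by
  cases y <;> simp

theorem elim_snoc_last {M : Type*} (v : α → M) (xs : Fin n → M) (z : M) :
    Sum.elim v (Fin.snoc xs z : Fin (n + 1) → M) (Sum.inr (Fin.last n)) = z := by
  simp

theorem realize_ballF (y : α ⊕ Fin n) (φ : setLang.BoundedFormula α (n + 1))
    (v : α → ZFSet.{u}) (xs : Fin n → ZFSet.{u}) :
    (ballF y φ).Realize v xs ↔ ∀ z ∈ Sum.elim v xs y, φ.Realize v (Fin.snoc xs z) := by
  simp only [ballF, Language.BoundedFormula.realize_all, Language.BoundedFormula.realize_imp,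
    realize_memF, elim_snoc_lift, elim_snoc_last]

theorem realize_ballF_subtype {P : ZFSet.{u} → Prop} (y : α ⊕ Fin n)
    (φ : setLang.BoundedFormula α (n + 1)) (v : α → {x // P x}) (xs : Fin n → {x // P x}) :
    (ballF y φ).Realize v xs ↔
      ∀ z : {x // P x}, z.1 ∈ (Sum.elim v xs y).1 → φ.Realize v (Fin.snoc xs z) := by
  simp only [ballF, Language.BoundedFormula.realize_all, Language.BoundedFormula.realize_imp,
    realize_memF_subtype, elim_snoc_lift, elim_snoc_last]

theorem val_comp_snoc {P : ZFSet.{u} → Prop} (xs : Fin n → {x // P x}) (z : {x // P x}) :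
    (fun i => ((Fin.snoc xs z : Fin (n + 1) → {x // P x}) i).1) =
      (Fin.snoc (fun i => (xs i).1) z.1 : Fin (n + 1) → ZFSet.{u}) := by
  funext i
  refine Fin.lastCases ?_ (fun j => ?_) i <;> simp

theorem val_elim {P : ZFSet.{u} → Prop} (v : α → {x // P x}) (xs : Fin n → {x // P x})
    (y : α ⊕ Fin n) :
    (Sum.elim v xs y).1 = Sum.elim (fun i => (v i).1) (fun i => (xs i).1) y := by
  cases y <;> rfl

/-- Transitive classes are absolute for Δ₀ formulas. -/
theorem IsDeltaZero.realize_iff {P : ZFSet.{u} → Prop} (hP : IsTransitiveClass P)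
    {φ : setLang.BoundedFormula α n} (hφ : IsDeltaZero φ) (v : α → {x // P x})
    (xs : Fin n → {x // P x}) :
    φ.Realize v xs ↔ φ.Realize (fun i => (v i).1) (fun i => (xs i).1) := by
  induction hφ with
  | falsum => rfl
  | equal s t =>
    obtain ⟨i, rfl⟩ := term_eq_var s
    obtain ⟨j, rfl⟩ := term_eq_var t
    change Sum.elim v xs i = Sum.elim v xs j ↔ _
    rw [Subtype.ext_iff, val_elim, val_elim]
    rfl
  | mem s t =>
    obtain ⟨i, rfl⟩ := term_eq_var s
    obtain ⟨j, rfl⟩ := term_eq_var t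
    rw [realize_memF_subtype, val_elim, val_elim, realize_memF]
  | imp _ _ ih₁ ih₂ =>
    rw [Language.BoundedFormula.realize_imp, Language.BoundedFormula.realize_imp, ih₁, ih₂]
  | ball y _ ih =>
    rw [realize_ballF_subtype, realize_ballF]
    simp only [ih, val_comp_snoc, ← val_elim]
    -- Transitivity is used only here: all members of `y` lie in `P`, so the bounded quantifier has
    -- the same range in both structures.
    exact ⟨fun h z hz => h ⟨z, hP _ (Sum.elim v xs y).2 z hz⟩ hz, fun h z hz => h z.1 hz⟩

/-- Σ₁ formulas are upward absolute from transitive classes. -/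
theorem IsSigmaOne.realize_of_subtype {P : ZFSet.{u} → Prop} (hP : IsTransitiveClass P)
    {φ : setLang.BoundedFormula α n} (hφ : IsSigmaOne φ) (v : α → {x // P x})
    (xs : Fin n → {x // P x}) (h : φ.Realize v xs) :
    φ.Realize (fun i => (v i).1) (fun i => (xs i).1) := by
  induction hφ with
  | deltaZero hφ => exact (hφ.realize_iff hP v xs).1 h
  | ex _ ih =>
    obtain ⟨z, hz⟩ := Language.BoundedFormula.realize_ex.1 h
    refine Language.BoundedFormula.realize_ex.2 ⟨z.1, ?_⟩
    rw [← val_comp_snoc]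
    exact ih _ hz

end Realize

/-- The relation `R` between finitely many sets is defined by a Δ₀ formula. -/
def DeltaZeroDefinable {α : Type w} {n : ℕ} (R : (α ⊕ Fin n → ZFSet.{u}) → Prop) : Prop :=
  ∃ φ : setLang.BoundedFormula α n, IsDeltaZero φ ∧
    ∀ (v : α → ZFSet.{u}) (xs : Fin n → ZFSet.{u}), φ.Realize v xs ↔ R (Sum.elim v xs)

/-- The assignment `e`, extended by the value `z` for a new bound variable. -/
def extend {α : Type w} {n : ℕ} (e : α ⊕ Fin n → ZFSet.{u}) (z : ZFSet.{u}) :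
    α ⊕ Fin (n + 1) → ZFSet.{u} :=
  Sum.elim (e ∘ Sum.inl) (Fin.snoc (e ∘ Sum.inr) z : Fin (n + 1) → ZFSet.{u})

/-- A variable, in the scope of one more bound variable. -/
def lift {α : Type w} {n : ℕ} (y : α ⊕ Fin n) : α ⊕ Fin (n + 1) := Sum.map id Fin.castSucc y

/-- The bound variable that was introduced last. -/
def new {α : Type w} {n : ℕ} : α ⊕ Fin (n + 1) := Sum.inr (Fin.last n)

@[simp]
theorem extend_lift {α : Type w} {n : ℕ} (e : α ⊕ Fin n → ZFSet.{u}) (z : ZFSet.{u})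
    (y : α ⊕ Fin n) : extend e z (lift y) = e y := by
  rw [extend, lift, elim_snoc_lift]
  cases y <;> rfl

@[simp]
theorem extend_new {α : Type w} {n : ℕ} (e : α ⊕ Fin n → ZFSet.{u}) (z : ZFSet.{u}) :
    extend e z new = z := by
  simp [extend, new]

theorem extend_elim {α : Type w} {n : ℕ} (v : α → ZFSet.{u}) (xs : Fin n → ZFSet.{u})
    (z : ZFSet.{u}) : extend (Sum.elim v xs) z = Sum.elim v (Fin.snoc xs z) :=
  rfl

namespace DeltaZeroDefinable

variable {α : Type w} {n : ℕ} {R S : (α ⊕ Fin n → ZFSet.{u}) → Prop}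

theorem congr (hR : DeltaZeroDefinable R) (h : ∀ e, S e ↔ R e) : DeltaZeroDefinable S := by
  obtain ⟨φ, hφ, hR⟩ := hR
  exact ⟨φ, hφ, fun v xs => (hR v xs).trans (h _).symm⟩

theorem mem (x y : α ⊕ Fin n) : DeltaZeroDefinable.{u} fun e => e x ∈ e y :=
  ⟨_, .mem (Language.Term.var x) (Language.Term.var y), fun _ _ => Iff.rfl⟩

theorem eq (x y : α ⊕ Fin n) : DeltaZeroDefinable.{u} fun e => e x = e y :=
  ⟨_, .equal (Language.Term.var x) (Language.Term.var y), fun _ _ => Iff.rfl⟩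

theorem imp (hR : DeltaZeroDefinable R) (hS : DeltaZeroDefinable S) :
    DeltaZeroDefinable fun e => R e → S e := by
  obtain ⟨φ, hφ, hR⟩ := hR
  obtain ⟨ψ, hψ, hS⟩ := hS
  exact ⟨_, hφ.imp hψ, fun v xs => by rw [Language.BoundedFormula.realize_imp, hR, hS]⟩

theorem not (hR : DeltaZeroDefinable R) : DeltaZeroDefinable fun e => ¬ R e :=
  hR.imp ⟨_, .falsum, fun _ _ => Iff.rfl⟩

theorem or (hR : DeltaZeroDefinable R) (hS : DeltaZeroDefinable S) :
    DeltaZeroDefinable fun e => R e ∨ S e :=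
  (hR.not.imp hS).congr fun _ => or_iff_not_imp_left

theorem and (hR : DeltaZeroDefinable R) (hS : DeltaZeroDefinable S) :
    DeltaZeroDefinable fun e => R e ∧ S e :=
  (hR.imp hS.not).not.congr fun _ => by simp

theorem ball (y : α ⊕ Fin n) {R : (α ⊕ Fin (n + 1) → ZFSet.{u}) → Prop}
    (hR : DeltaZeroDefinable R) : DeltaZeroDefinable fun e => ∀ z ∈ e y, R (extend e z) := by
  obtain ⟨φ, hφ, hR⟩ := hR
  exact ⟨_, hφ.ball y, fun v xs => by simp only [realize_ballF, hR, extend_elim]⟩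

theorem bex (y : α ⊕ Fin n) {R : (α ⊕ Fin (n + 1) → ZFSet.{u}) → Prop}
    (hR : DeltaZeroDefinable R) : DeltaZeroDefinable fun e => ∃ z ∈ e y, R (extend e z) :=
  (ball y hR.not).not.congr fun _ => by simp

theorem eq_unorderedPair (x a b : α ⊕ Fin n) :
    DeltaZeroDefinable.{u} fun e => e x = {e a, e b} := by
  refine ((mem a x).and ((mem b x).and (ball x ((eq new (lift a)).or (eq new (lift b)))))).congr
    fun e => ?_
  simp only [extend_lift, extend_new]
  constructor
  · intro h
    simp [h]
  · rintro ⟨ha, hb, h⟩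
    ext z
    rw [ZFSet.mem_pair]
    refine ⟨h z, ?_⟩
    rintro (rfl | rfl) <;> assumption

/-- The components `{a}` (read as `{a, a}`) and `{a, b}` are members of `x`, so quantifiers bounded
by `x` suffice. -/
theorem eq_pair (x a b : α ⊕ Fin n) :
    DeltaZeroDefinable.{u} fun e => e x = ZFSet.pair (e a) (e b) := by
  refine ((bex x (eq_unorderedPair new (lift a) (lift a))).and
    ((bex x (eq_unorderedPair new (lift a) (lift b))).and
      (ball x ((eq_unorderedPair new (lift a) (lift a)).or
        (eq_unorderedPair new (lift a) (lift b)))))).congr fun e => ?_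
  simp only [extend_lift, extend_new, ZFSet.pair_eq_singleton, exists_eq_right]
  constructor
  · intro h
    simp [h, ZFSet.pair]
  · rintro ⟨ha, hb, h⟩
    ext z
    rw [ZFSet.pair, ZFSet.mem_pair]
    refine ⟨h z, ?_⟩
    rintro (rfl | rfl) <;> assumption

theorem pair_mem (a b x : α ⊕ Fin n) :
    DeltaZeroDefinable.{u} fun e => ZFSet.pair (e a) (e b) ∈ e x :=
  (bex x (eq_pair new (lift a) (lift b))).congr fun e => by simp

end DeltaZeroDefinable

/-! ### Σ₁-correct ordinals -/

namespace SigmaOneCorrect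

variable {κ : Ordinal.{u}}

/-- If there are sets in a given Δ₀ relation to parameters in `V_κ`, then there are such sets
in `V_κ`. -/
theorem exists_mem_vonNeumann (hκ : SigmaOneCorrect κ) {n : ℕ}
    {R : (Fin n ⊕ Fin 2 → ZFSet.{u}) → Prop} (hR : DeltaZeroDefinable R) (a : Fin n → ZFSet.{u})
    (ha : ∀ i, a i ∈ ZFSet.vonNeumann κ) (h : ∃ x y, R (Sum.elim a ![x, y])) :
    ∃ x ∈ ZFSet.vonNeumann κ, ∃ y ∈ ZFSet.vonNeumann κ, R (Sum.elim a ![x, y]) := by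
  obtain ⟨φ, hφ, hR⟩ := hR
  have hsnoc : ∀ {M : Type (u + 1)} (d : Fin 0 → M) (x y : M),
      (Fin.snoc (Fin.snoc d x : Fin 1 → M) y : Fin 2 → M) = ![x, y] := by
    intro M d x y
    funext i
    fin_cases i <;> rfl
  -- Correctness pulls the two existential quantifiers down to `V_κ`; the Δ₀ matrix then returns to
  -- `V` by absoluteness.
  have key := hκ n φ.ex.ex (.ex (.ex (.deltaZero hφ))) fun i => ⟨a i, ha i⟩
  simp only [Language.Formula.Realize, Language.BoundedFormula.realize_ex, hsnoc, hR] at key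
  obtain ⟨x, y, hxy⟩ := key.2 h
  rw [hφ.realize_iff (fun x hx y hy => (ZFSet.isTransitive_vonNeumann κ).mem_trans hy hx), hR]
    at hxy
  refine ⟨x.1, x.2, y.1, y.2, ?_⟩
  convert hxy using 2
  funext i
  fin_cases i <;> rfl

/-- Some set has `V_o` as a member, hence so does some set in `V_κ`, and the rank of that set
exceeds `o`. The second witness is a dummy. -/
theorem succ_lt (hκ : SigmaOneCorrect κ) {o : Ordinal.{u}} (ho : o < κ) : Order.succ o < κ := by
  obtain ⟨x, hx, _, -, h⟩ := hκ.exists_mem_vonNeumann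
    (DeltaZeroDefinable.mem (Sum.inl (0 : Fin 1)) (Sum.inr 0)) (fun _ => ZFSet.vonNeumann o)
    (fun _ => ZFSet.vonNeumann_mem_of_lt ho) ⟨{ZFSet.vonNeumann o}, ∅, by simp⟩
  have h := ZFSet.rank_lt_of_mem h
  rw [ZFSet.mem_vonNeumann] at hx
  refine (Order.succ_le_of_lt ?_).trans_lt hx
  simpa using h

/-- A nonempty set each of whose members belongs to another of its members has rank at least `ω`,
and `V_ω` is such a set. The statement has no parameters, so it reflects without knowing that `V_κ`
is nonempty. -/
theorem omega0_lt (hκ : SigmaOneCorrect κ) : Ordinal.omega0 < κ := by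
  obtain ⟨x, hx, y, -, hyx, h⟩ := hκ.exists_mem_vonNeumann (n := 0)
    ((DeltaZeroDefinable.mem (Sum.inr 1) (Sum.inr 0)).and
      (.ball (Sum.inr 0) (.bex (lift (Sum.inr 0)) (.mem (lift new) new)))) Fin.elim0
    (fun i => i.elim0) ⟨ZFSet.vonNeumann Ordinal.omega0, ∅, by
      simp only [extend_lift, extend_new, Sum.elim_inr, Matrix.cons_val_zero, Matrix.cons_val_one]
      refine ⟨by simp [ZFSet.mem_vonNeumann], fun z hz => ⟨{z}, ?_, by simp⟩⟩
      rw [ZFSet.mem_vonNeumann] at hz ⊢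
      simpa using (Ordinal.isSuccLimit_omega0.succ_lt hz)⟩
  simp only [extend_lift, extend_new, Sum.elim_inr, Matrix.cons_val_zero, Matrix.cons_val_one]
    at hyx h
  have key : ∀ k : ℕ, ∃ z ∈ x, (k : Ordinal.{u}) ≤ z.rank := by
    intro k
    induction k with
    | zero => exact ⟨y, hyx, by simp⟩
    | succ k ih =>
      obtain ⟨z, hz, hkz⟩ := ih
      obtain ⟨z', hz', hzz'⟩ := h z hz
      refine ⟨z', hz', ?_⟩
      rw [Nat.cast_succ]
      exact Order.add_one_le_of_lt (hkz.trans_lt (ZFSet.rank_lt_of_mem hzz'))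
  refine lt_of_le_of_lt ?_ (ZFSet.mem_vonNeumann.1 hx)
  rw [Ordinal.omega0_le]
  intro k
  obtain ⟨z, hz, hk⟩ := key k
  exact hk.trans (ZFSet.rank_lt_of_mem hz).le

/-- Kuratowski pairs live two power sets above `x ∪ y`, and `κ` is closed under successors. -/
theorem prod_mem_vonNeumann (hκ : SigmaOneCorrect κ) {x y : ZFSet.{u}}
    (hx : x ∈ ZFSet.vonNeumann κ) (hy : y ∈ ZFSet.vonNeumann κ) :
    x.prod y ∈ ZFSet.vonNeumann κ := by
  rw [ZFSet.mem_vonNeumann] at hx hy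
  have : x.prod y ⊆ ZFSet.powerset (ZFSet.powerset (x ∪ y)) := by
    intro z hz
    obtain ⟨a, ha, b, hb, rfl⟩ := ZFSet.mem_prod.1 hz
    simp only [ZFSet.mem_powerset, ZFSet.pair]
    intro u hu
    rw [ZFSet.mem_powerset]
    intro w hw
    rw [ZFSet.mem_union]
    rcases ZFSet.mem_pair.1 hu with rfl | rfl
    · exact Or.inl (ZFSet.mem_singleton.1 hw ▸ ha)
    · rcases ZFSet.mem_pair.1 hw with rfl | rfl
      · exact Or.inl ha
      · exact Or.inr hb
  refine ZFSet.mem_vonNeumann_of_subset this ?_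
  rw [ZFSet.mem_vonNeumann]
  simp only [ZFSet.rank_powerset, ZFSet.rank_union]
  exact hκ.succ_lt (hκ.succ_lt (max_lt hx hy))

end SigmaOneCorrect

/-! ### The Mostowski collapse -/

instance small_mem_and (N : Set ZFSet.{u}) (a : ZFSet.{u}) :
    Small.{u} {b : ZFSet.{u} // b ∈ a ∧ b ∈ N} :=
  small_of_injective (β := {b : ZFSet.{u} // b ∈ a}) (f := fun b => ⟨b.1, b.2.1⟩)
    fun _ _ h => Subtype.ext (by simpa using h)

/-- The Mostowski collapse of the structure `(N, ∈)`. -/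
def collapse (N : Set ZFSet.{u}) (a : ZFSet.{u}) : ZFSet.{u} :=
  ZFSet.range fun b : {b : ZFSet.{u} // b ∈ a ∧ b ∈ N} => collapse N b.1
termination_by a
decreasing_by exact b.2.1

theorem mem_collapse {N : Set ZFSet.{u}} {a y : ZFSet.{u}} :
    y ∈ collapse N a ↔ ∃ b ∈ a, b ∈ N ∧ collapse N b = y := by
  rw [collapse]
  simp [and_assoc]

theorem collapse_mem_collapse {N : Set ZFSet.{u}} {a b : ZFSet.{u}} (hb : b ∈ N) (h : b ∈ a) :
    collapse N b ∈ collapse N a :=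
  mem_collapse.2 ⟨b, h, hb, rfl⟩

/-- By `∈`-induction: since `D` is transitive and contained in `N`, the collapse drops no member of
`a`. -/
theorem collapse_eq_self {N : Set ZFSet.{u}} {D : ZFSet.{u}} (hD : D.IsTransitive)
    (hDN : ∀ z ∈ D, z ∈ N) (a : ZFSet.{u}) (ha : a ∈ D) : collapse N a = a := by
  induction a using ZFSet.inductionOn with
  | _ a ih =>
    ext z
    rw [mem_collapse]
    constructor
    · rintro ⟨b, hba, -, rfl⟩
      rwa [ih b hba (hD.mem_trans hba ha)]
    · intro hz
      have hzD := hD.mem_trans hz ha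
      exact ⟨z, hz, hDN z hzD, ih z hz hzD⟩

/-- The structure `(N, ∈)` satisfies the axiom of extensionality. -/
def IsExtensional (N : Set ZFSet.{u}) : Prop :=
  ∀ a ∈ N, ∀ b ∈ N, (∀ c ∈ N, c ∈ a ↔ c ∈ b) → a = b

/-- By `∈`-induction on `a`: if `a` and `b` have equal collapses, each member of one in `N` has the
same collapse as some member of the other in `N`. The induction hypothesis, applied to the one in
`a`, identifies the two, and extensionality finishes. -/
theorem IsExtensional.injOn_collapse {N : Set ZFSet.{u}} (hN : IsExtensional N) :
    Set.InjOn (collapse N) N := by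
  intro a
  induction a using ZFSet.inductionOn with
  | _ a ih =>
    intro ha b hb hab
    refine hN a ha b hb fun c hc => ⟨fun hca => ?_, fun hcb => ?_⟩
    · have h := collapse_mem_collapse hc hca
      rw [hab, mem_collapse] at h
      obtain ⟨d, hdb, hd, hdc⟩ := h
      rwa [ih c hca hc hd hdc.symm]
    · have h := collapse_mem_collapse hc hcb
      rw [← hab, mem_collapse] at h
      obtain ⟨d, hda, hd, hdc⟩ := h
      rwa [← ih d hda hd hc hdc]

theorem IsExtensional.collapse_mem_collapse_iff {N : Set ZFSet.{u}} (hN : IsExtensional N)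
    {a b : ZFSet.{u}} (ha : a ∈ N) : collapse N a ∈ collapse N b ↔ a ∈ b := by
  refine ⟨fun h => ?_, collapse_mem_collapse ha⟩
  obtain ⟨c, hcb, hc, hca⟩ := mem_collapse.1 h
  rwa [← hN.injOn_collapse hc ha hca]

/-- If `N` is equinumerous with a member of `V_κ`, where `κ` is Σ₁-correct, then all values of
the Mostowski collapse of `N` are in `V_κ`. -/
theorem SigmaOneCorrect.collapse_mem {κ : Ordinal.{u}} (hκ : SigmaOneCorrect κ)
    {D : ZFSet.{u}} (hD : D ∈ ZFSet.vonNeumann κ) {N : Set ZFSet.{u}}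
    (e : {z : ZFSet.{u} // z ∈ D} ≃ N) {a : ZFSet.{u}} (ha : a ∈ N) :
    collapse N a ∈ ZFSet.vonNeumann κ := by
  -- `E` copies `∈` on `N` to `D` along `e`; unlike `N`, it is visibly a member of `V_κ`.
  let E : ZFSet.{u} := ZFSet.pairSep
    (fun c d => ∃ (hc : c ∈ D) (hd : d ∈ D), (e ⟨c, hc⟩).1 ∈ (e ⟨d, hd⟩).1) D D
  have hE : ∀ c d : {z : ZFSet.{u} // z ∈ D},
      ZFSet.pair c.1 d.1 ∈ E ↔ (e c).1 ∈ (e d).1 := by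
    intro c d
    simp only [E, ZFSet.mem_pairSep, ZFSet.pair_inj]
    constructor
    · rintro ⟨_, -, _, -, ⟨rfl, rfl⟩, _, _, h⟩
      exact h
    · exact fun h => ⟨_, c.2, _, d.2, ⟨rfl, rfl⟩, c.2, d.2, h⟩
  have hEκ : E ∈ ZFSet.vonNeumann κ := by
    refine ZFSet.mem_vonNeumann_of_subset (fun z hz => ?_) (hκ.prod_mem_vonNeumann hD hD)
    obtain ⟨c, hc, d, hd, rfl, -⟩ := ZFSet.mem_pairSep.1 hz
    exact ZFSet.pair_mem_prod.2 ⟨hc, hd⟩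
  -- The recursion defining the collapse of `(D, E)`, as a Δ₀ condition on `f` and a set `W` of
  -- values. `W` serves to bound the quantifiers; single-valuedness of `f` need not be demanded.
  obtain ⟨W, hW, f, -, h⟩ := hκ.exists_mem_vonNeumann (n := 2)
    (R := fun s => (∀ d ∈ s (.inl 0), ∃ y ∈ s (.inr 0), ZFSet.pair d y ∈ s (.inr 1)) ∧
      ∀ d ∈ s (.inl 0), ∀ y ∈ s (.inr 0), ZFSet.pair d y ∈ s (.inr 1) →
        (∀ z ∈ y, ∃ c ∈ s (.inl 0), ZFSet.pair c d ∈ s (.inl 1) ∧ z ∈ s (.inr 0) ∧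
          ZFSet.pair c z ∈ s (.inr 1)) ∧
        (∀ c ∈ s (.inl 0), ZFSet.pair c d ∈ s (.inl 1) →
          ∀ z ∈ s (.inr 0), ZFSet.pair c z ∈ s (.inr 1) → z ∈ y))
    (by
      refine ((DeltaZeroDefinable.ball (.inl 0) (.bex (lift (.inr 0))
        (.pair_mem (lift new) new (lift (lift (.inr 1)))))).and
        (.ball (.inl 0) (.ball (lift (.inr 0)) (.imp (.pair_mem (lift new) new
          (lift (lift (.inr 1)))) (.and
          (.ball new (.bex (lift (lift (lift (.inl 0)))) (.and
            (.pair_mem new (lift (lift (lift new))) (lift (lift (lift (lift (.inl 1))))))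
            (.and (.mem (lift new) (lift (lift (lift (lift (.inr 0))))))
              (.pair_mem new (lift new) (lift (lift (lift (lift (.inr 1))))))))))
          (.ball (lift (lift (.inl 0))) (.imp
            (.pair_mem new (lift (lift new)) (lift (lift (lift (.inl 1)))))
            (.ball (lift (lift (lift (.inr 0)))) (.imp
              (.pair_mem (lift new) new (lift (lift (lift (lift (.inr 1))))))
              (.mem new (lift (lift new)))))))))))).congr fun s => ?_
      simp only [extend_lift, extend_new])
    ![D, E] (by intro i; fin_cases i <;> assumption)
    ⟨ZFSet.range fun d : {z : ZFSet.{u} // z ∈ D} => collapse N (e d).1,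
      ZFSet.range fun d : {z : ZFSet.{u} // z ∈ D} => ZFSet.pair d.1 (collapse N (e d).1), by
      simp only [Sum.elim_inl, Sum.elim_inr, Matrix.cons_val_zero, Matrix.cons_val_one]
      have hf : ∀ (d : {z : ZFSet.{u} // z ∈ D}) (y : ZFSet.{u}), ZFSet.pair d.1 y ∈
          (ZFSet.range fun d : {z : ZFSet.{u} // z ∈ D} =>
            ZFSet.pair d.1 (collapse N (e d).1)) ↔ y = collapse N (e d).1 := by
        intro d y
        rw [ZFSet.mem_range]
        constructor
        · rintro ⟨d', h⟩
          obtain ⟨h₁, rfl⟩ := ZFSet.pair_inj.1 h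
          rw [Subtype.ext h₁]
        · rintro rfl
          exact ⟨d, rfl⟩
      refine ⟨fun d hd => ⟨_, ZFSet.mem_range_self ⟨d, hd⟩, (hf ⟨d, hd⟩ _).2 rfl⟩,
        fun d hd y _ hdy => ?_⟩
      obtain rfl := (hf ⟨d, hd⟩ y).1 hdy
      refine ⟨fun z hz => ?_, fun c hc hcd z _ hcz => ?_⟩
      · obtain ⟨b, hb, hbN, rfl⟩ := mem_collapse.1 hz
        obtain ⟨c, hc⟩ := e.surjective ⟨b, hbN⟩
        have hc' : b = (e c).1 := by rw [hc]
        subst hc'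
        exact ⟨c.1, c.2, (hE c ⟨d, hd⟩).2 hb, ZFSet.mem_range_self c, (hf c _).2 rfl⟩
      · rw [(hf ⟨c, hc⟩ z).1 hcz]
        exact collapse_mem_collapse (e ⟨c, hc⟩).2 ((hE ⟨c, hc⟩ ⟨d, hd⟩).1 hcd)⟩
  simp only [Sum.elim_inl, Sum.elim_inr, Matrix.cons_val_zero, Matrix.cons_val_one] at h
  obtain ⟨hex, h⟩ := h
  -- Uniqueness, by `∈`-induction: the solution found in `V_κ` can only take the values of the true
  -- collapse.
  have key : ∀ a : ZFSet.{u}, ∀ d : {z : ZFSet.{u} // z ∈ D}, (e d).1 = a →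
      ∀ y ∈ W, ZFSet.pair d.1 y ∈ f → y = collapse N a := by
    intro a
    induction a using ZFSet.inductionOn with
    | _ a ih =>
      rintro d rfl y hy hdy
      obtain ⟨h₁, h₂⟩ := h d.1 d.2 y hy hdy
      ext z
      rw [mem_collapse]
      constructor
      · intro hz
        obtain ⟨c, hc, hcd, hzW, hcz⟩ := h₁ z hz
        have hcd := (hE ⟨c, hc⟩ d).1 hcd
        exact ⟨_, hcd, (e ⟨c, hc⟩).2, (ih _ hcd _ rfl z hzW hcz).symm⟩
      · rintro ⟨b, hb, hbN, rfl⟩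
        obtain ⟨c, hc⟩ := e.surjective ⟨b, hbN⟩
        have hc' : b = (e c).1 := by rw [hc]
        subst hc'
        obtain ⟨z, hz, hcz⟩ := hex c.1 c.2
        rw [← ih _ hb c rfl z hz hcz]
        exact h₂ c.1 c.2 ((hE c d).2 hb) z hz hcz
  obtain ⟨d, hd⟩ := e.surjective ⟨a, ha⟩
  obtain ⟨y, hy, hdy⟩ := hex d.1 d.2
  rw [← key a d (by rw [hd]) y hy hdy]
  exact (ZFSet.isTransitive_vonNeumann κ).mem_trans hy hW

/-! ### Elementary substructures of the universe -/

instance countable_setRel (n : ℕ) : Countable (SetRel n) :=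
  have : Subsingleton (SetRel n) := ⟨fun a b => by cases a; cases b; rfl⟩
  inferInstance

theorem card_setLang_le : setLang.card ≤ Cardinal.aleph0 := by
  have h₁ : ∀ n, Countable (setLang.Functions n) := fun _ => inferInstanceAs (Countable Empty)
  have h₂ : ∀ n, Countable (setLang.Relations n) := countable_setRel
  exact Cardinal.mk_le_aleph0_iff.2
    (inferInstanceAs (Countable ((Σ n, setLang.Functions n) ⊕ Σ n, setLang.Relations n)))

theorem infinite_vonNeumann {α : Ordinal.{u}} (hα : Ordinal.omega0 ≤ α) :
    Infinite {z : ZFSet.{u} // z ∈ ZFSet.vonNeumann α} :=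
  Infinite.of_injective
    (fun n : ℕ => ⟨ZFSet.vonNeumann n,
      ZFSet.vonNeumann_mem_of_lt ((Ordinal.natCast_lt_omega0 n).trans_le hα)⟩)
    fun _ _ h => Nat.cast_injective (ZFSet.vonNeumann_injective (Subtype.ext_iff.1 h))

/-- The structure `(P, ∈)` is an elementary substructure of `V`. -/
def IsElementaryClass (P : ZFSet.{u} → Prop) : Prop :=
  ∀ (n : ℕ) (φ : setLang.Formula (Fin n)) (a : Fin n → {x : ZFSet.{u} // P x}),
    φ.Realize a ↔ φ.Realize fun i => (a i : ZFSet.{u})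

/-- Every set belongs to an elementary substructure of `V` that includes `V_α` and is equinumerous
with it. -/
theorem exists_elementarySubstructure {α : Ordinal.{u}} (hα : Ordinal.omega0 ≤ α)
    (x : ZFSet.{u}) :
    ∃ N : Set ZFSet.{u}, IsElementaryClass (· ∈ N) ∧ (∀ z ∈ ZFSet.vonNeumann α, z ∈ N) ∧ x ∈ N ∧
      Nonempty ({z : ZFSet.{u} // z ∈ ZFSet.vonNeumann α} ≃ N) := by
  have := infinite_vonNeumann hα
  let s : Set ZFSet.{u} := insert x {z | z ∈ ZFSet.vonNeumann α}
  let c : Cardinal.{u + 1} := Cardinal.mk {z : ZFSet.{u} // z ∈ ZFSet.vonNeumann α}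
  have hc : Cardinal.aleph0 ≤ c := Cardinal.aleph0_le_mk _
  obtain ⟨S, hS, hcard⟩ := Language.exists_elementarySubstructure_card_eq setLang s c hc
    (by
      rw [Cardinal.lift_le]
      refine Cardinal.mk_insert_le.trans ?_
      exact (Cardinal.add_one_eq hc).le)
    (by
      refine (Cardinal.lift_le.2 card_setLang_le).trans ?_
      rw [Cardinal.lift_aleph0, Cardinal.aleph0_le_lift]
      exact hc)
    (by
      rw [Cardinal.lift_le]
      exact Cardinal.mk_subtype_le _)
  refine ⟨S, ?_, fun z hz => hS (Set.mem_insert_of_mem _ hz), hS (Set.mem_insert _ _), ?_⟩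
  · intro n φ a
    -- The induced structure and the `∈`-structure on the subtype are given by different instances,
    -- so they must be identified before elementarity transfers.
    have hstr : S.inducedStructure =
        instStructureSetLangSubtypeZFSet (· ∈ (S : Set ZFSet.{u})) := by
      ext n r xs
      · exact nomatch r
      · cases r
        rfl
    have h : φ.Realize (Subtype.val ∘ a) ↔
        @Language.Formula.Realize setLang S S.inducedStructure _ φ a := S.isElementary φ a
    rw [hstr] at h
    exact h.symm
  · rw [Cardinal.lift_inj] at hcard
    exact Cardinal.eq.1 hcard.symm

namespace IsElementaryClass

variable {P : ZFSet.{u} → Prop}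

/-- The inclusion of an elementary substructure of `V`. -/
def subtype (hP : IsElementaryClass P) : {x : ZFSet.{u} // P x} ↪ₑ[setLang] ZFSet.{u} where
  toFun := Subtype.val
  map_formula' n φ a := (hP n φ a).symm

theorem ext (hP : IsElementaryClass P) {a b : ZFSet.{u}} (ha : P a) (hb : P b)
    (h : ∀ c, P c → (c ∈ a ↔ c ∈ b)) :
    a = b := by
  let φ : setLang.Formula (Fin 2) := ((memF (Language.Term.var (.inr 0))
    (Language.Term.var (.inl 0))).iff (memF (Language.Term.var (.inr 0))
    (Language.Term.var (.inl 1)))).all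
  have h₁ : φ.Realize (![⟨a, ha⟩, ⟨b, hb⟩] : Fin 2 → {x : ZFSet.{u} // P x}) := by
    refine Language.BoundedFormula.realize_all.2 fun c => ?_
    exact Language.BoundedFormula.realize_iff.2 (h c.1 c.2)
  have h₂ := (hP 2 φ _).1 h₁
  refine ZFSet.ext fun c => ?_
  exact Language.BoundedFormula.realize_iff.1 (Language.BoundedFormula.realize_all.1 h₂ c)

theorem isExtensional {N : Set ZFSet.{u}} (hN : IsElementaryClass (· ∈ N)) : IsExtensional N :=
  fun _ ha _ hb h => hN.ext ha hb h

/-- The pair is definable from `a` and `b`: elementarity yields a set in `P` satisfying the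
definition, and in `V` only the pair does. -/
theorem unorderedPair_mem (hP : IsElementaryClass P) {a b : ZFSet.{u}} (ha : P a) (hb : P b) :
    P {a, b} := by
  obtain ⟨φ, -, hφ⟩ := DeltaZeroDefinable.eq_unorderedPair.{u}
    (Sum.inr 0 : Fin 2 ⊕ Fin 1) (.inl 0) (.inl 1)
  let v : Fin 2 → {x : ZFSet.{u} // P x} := ![⟨a, ha⟩, ⟨b, hb⟩]
  have h := (hP.subtype.map_boundedFormula φ.ex v default).1
    (Language.BoundedFormula.realize_ex.2 ⟨{a, b}, (hφ _ _).2 rfl⟩)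
  obtain ⟨z, hz⟩ := Language.BoundedFormula.realize_ex.1 h
  have hz' := (hφ _ _).1 ((hP.subtype.map_boundedFormula φ v _).2 hz)
  exact (show z.1 = {a, b} from hz') ▸ z.2

end IsElementaryClass

/-- The Mostowski collapse of an elementary substructure of `V`, as an isomorphism. -/
def collapseEquiv {N : Set ZFSet.{u}} (hN : IsElementaryClass (· ∈ N)) [Small.{u} N] :
    {x : ZFSet.{u} // x ∈ N} ≃[setLang]
      {y : ZFSet.{u} // y ∈ ZFSet.range fun a : N => collapse N a.1} where
  toEquiv := Equiv.ofBijective (fun a => ⟨collapse N a.1, ZFSet.mem_range_self (α := N) a⟩) <| by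
    refine ⟨fun a b h => ?_, fun y => ?_⟩
    · exact Subtype.ext (hN.isExtensional.injOn_collapse a.2 b.2 (congrArg Subtype.val h))
    · obtain ⟨a, ha⟩ := ZFSet.mem_range.1 y.2
      exact ⟨a, Subtype.ext ha⟩
  map_fun' f := nomatch f
  map_rel' r xs := by
    cases r
    exact hN.isExtensional.collapse_mem_collapse_iff (xs 0).2

/-- The Mostowski collapse of an elementary substructure of `V` preserves Σ₁ formulas. -/
theorem IsSigmaOne.realize_collapse {n : ℕ} {φ : setLang.Formula (Fin n)} (hφ : IsSigmaOne φ)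
    {N : Set ZFSet.{u}} (hN : IsElementaryClass (· ∈ N)) [Small.{u} N]
    (v : Fin n → ZFSet.{u}) (hv : ∀ i, v i ∈ N) (h : φ.Realize v) :
    φ.Realize fun i => collapse N (v i) := by
  -- Truth passes from `V` down to `N` by elementarity, across the collapse by isomorphism, and back
  -- up to `V`; only the last passage needs `φ` to be Σ₁.
  have h₁ := (hN n φ fun i => ⟨v i, hv i⟩).2 h
  have h₂ := (Language.StrongHomClass.realize_formula (collapseEquiv hN) φ).2 h₁
  have hP : IsTransitiveClass
      fun y : ZFSet.{u} => y ∈ ZFSet.range fun a : N => collapse N a.1 := by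
    intro x hx y hy
    obtain ⟨a, rfl⟩ := ZFSet.mem_range.1 hx
    obtain ⟨b, -, hb, rfl⟩ := mem_collapse.1 hy
    exact ZFSet.mem_range_self (⟨b, hb⟩ : N)
  have hc : ∀ a : {x : ZFSet.{u} // x ∈ N}, (collapseEquiv hN a).1 = collapse N a.1 :=
    fun _ => rfl
  have h₃ := hφ.realize_of_subtype hP _ _ h₂
  rw [Subsingleton.elim (fun i => _) (default : Fin 0 → ZFSet.{u})] at h₃
  simp only [Function.comp_apply, hc] at h₃
  rw [Language.Formula.Realize]
  convert h₃

/-- Let `κ` be Σ₁-correct, let `C` be Σ₁-definable with parameters in `V_κ`, and let `β < κ`.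
Then every member `x` of `C` is reflected to some member `y` of `C ∩ V_κ`, by a partial map `j` from
a transitive class `M` into `V` that preserves `∈` and ordered pairs and is the identity on `V_β`. -/
theorem SigmaOneDefinable.exists_reflection {κ : Ordinal.{u}} (hκ : SigmaOneCorrect κ)
    {C : Set ZFSet.{u}} (hC : SigmaOneDefinable {x | x ∈ ZFSet.vonNeumann κ} C)
    {β : Ordinal.{u}} (hβ : β < κ) {x : ZFSet.{u}} (hx : x ∈ C) :
    ∃ y ∈ C, y ∈ ZFSet.vonNeumann κ ∧ ∃ (M : Set ZFSet.{u}) (j : ZFSet.{u} → ZFSet.{u}),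
      IsTransitiveClass (· ∈ M) ∧ y ∈ M ∧ j y = x ∧
      (∀ z ∈ ZFSet.vonNeumann β, z ∈ M ∧ j z = z) ∧
      (∀ a ∈ M, ∀ b ∈ M, a ∈ b → j a ∈ j b) ∧
      ∀ a ∈ M, ∀ b ∈ M, j (ZFSet.pair a b) = ZFSet.pair (j a) (j b) := by
  obtain ⟨n, φ, p, hφ, hp, hC⟩ := hC
  -- Here `ω` serves Löwenheim–Skolem, `β` makes `j` the identity on `V_β`, and the successors put
  -- each parameter into `V_α`.
  let α : Ordinal.{u} :=
    max (max Ordinal.omega0 β) (Finset.univ.sup fun i => Order.succ (p i).rank)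
  have hακ : α < κ := by
    refine max_lt (max_lt hκ.omega0_lt hβ) ?_
    rw [Finset.sup_lt_iff ((zero_le).trans_lt hκ.omega0_lt)]
    exact fun i _ => hκ.succ_lt (ZFSet.mem_vonNeumann.1 (hp i))
  have hpα : ∀ i, p i ∈ ZFSet.vonNeumann α := fun i => by
    rw [ZFSet.mem_vonNeumann]
    refine (Order.lt_succ _).trans_le (le_max_of_le_right ?_)
    exact Finset.le_sup (f := fun i => Order.succ (p i).rank) (Finset.mem_univ i)
  obtain ⟨N, hN', hαN, hxN, ⟨e⟩⟩ :=
    exists_elementarySubstructure ((le_max_left _ β).trans (le_max_left _ _) : _ ≤ α) x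
  have : Small.{u} N := small_of_injective e.symm.injective
  have hN := hN'.isExtensional
  have hid : ∀ z ∈ ZFSet.vonNeumann α, collapse N z = z :=
    collapse_eq_self (ZFSet.isTransitive_vonNeumann α) hαN
  let j := Function.invFunOn (collapse N) N
  have hj : ∀ a ∈ N, j (collapse N a) = a := fun a ha => hN.injOn_collapse.leftInvOn_invFunOn ha
  have hpair : ∀ a ∈ N, ∀ b ∈ N, ({a, b} : ZFSet.{u}) ∈ N ∧
      collapse N {a, b} = {collapse N a, collapse N b} := by
    intro a ha b hb
    refine ⟨hN'.unorderedPair_mem ha hb, ?_⟩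
    ext z
    rw [mem_collapse, ZFSet.mem_pair]
    constructor
    · rintro ⟨c, hc, -, rfl⟩
      rcases ZFSet.mem_pair.1 hc with rfl | rfl <;> simp
    · rintro (rfl | rfl)
      · exact ⟨a, by simp, ha, rfl⟩
      · exact ⟨b, by simp, hb, rfl⟩
  refine ⟨collapse N x, (hC _).2 ?_,
    hκ.collapse_mem (ZFSet.vonNeumann_mem_of_lt hακ) e hxN, collapse N '' N, j, ?_,
    ⟨x, hxN, rfl⟩, hj x hxN, fun z hz => ?_, ?_, ?_⟩
  · have h := hφ.realize_collapse hN' _ (Fin.cases hxN fun i => hαN _ (hpα i)) ((hC x).1 hx)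
    convert h using 1
    funext i
    exact Fin.cases rfl (fun i => (hid _ (hpα i)).symm) i
  · rintro _ ⟨a, -, rfl⟩ z hz
    obtain ⟨b, -, hb, rfl⟩ := mem_collapse.1 hz
    exact ⟨b, hb, rfl⟩
  · have hz := ZFSet.vonNeumann_subset_of_le
      ((le_max_right Ordinal.omega0 β).trans (le_max_left _ _) : _ ≤ α) hz
    refine ⟨⟨z, hαN z hz, hid z hz⟩, ?_⟩
    have h := hj z (hαN z hz)
    rwa [hid z hz] at h
  · rintro _ ⟨a, ha, rfl⟩ _ ⟨b, hb, rfl⟩ h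
    rw [hj a ha, hj b hb]
    exact (hN.collapse_mem_collapse_iff ha).1 h
  · rintro _ ⟨a, ha, rfl⟩ _ ⟨b, hb, rfl⟩
    -- A Kuratowski pair is built by three unordered pairings, each of which stays in `N` and
    -- commutes with the collapse.
    obtain ⟨h₁, h₁'⟩ := hpair a ha a ha
    obtain ⟨h₂, h₂'⟩ := hpair a ha b hb
    obtain ⟨h₃, h₃'⟩ := hpair _ h₁ _ h₂
    rw [hj a ha, hj b hb, ZFSet.pair, ZFSet.pair, ← ZFSet.pair_eq_singleton a,
      ← ZFSet.pair_eq_singleton (collapse N a), ← h₁', ← h₂', ← h₃', hj _ h₃]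

/-! ### Existence of Σ₁-correct ordinals -/

open Classical in
/-- A strict bound for the rank of some witness `z` of `φ(a, z)`, if there is one. -/
def witnessBound {n : ℕ} (φ : setLang.BoundedFormula Empty (n + 1)) (a : Fin n → ZFSet.{u}) :
    Ordinal.{u} :=
  if h : ∃ z : ZFSet.{u}, φ.Realize (@default _ Unique.instInhabited) (Fin.snoc a z) then
    Order.succ h.choose.rank
  else 0

theorem exists_mem_vonNeumann_witnessBound {n : ℕ} {φ : setLang.BoundedFormula Empty (n + 1)}
    {a : Fin n → ZFSet.{u}}
    (h : ∃ z : ZFSet.{u}, φ.Realize (@default _ Unique.instInhabited) (Fin.snoc a z)) :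
    ∃ z ∈ ZFSet.vonNeumann (witnessBound φ a),
      φ.Realize (@default _ Unique.instInhabited) (Fin.snoc a z) := by
  refine ⟨h.choose, ?_, h.choose_spec⟩
  rw [ZFSet.mem_vonNeumann, witnessBound, dif_pos h]
  exact Order.lt_succ _

/-- A level of the cumulative hierarchy that contains witnesses for all formulas with parameters
in `V_α`, if there are any. -/
def witnessLevel (α : Ordinal.{u}) : Ordinal.{u} :=
  max (Order.succ α) (⨆ i : Σ n : ℕ, setLang.BoundedFormula Empty (n + 1) ×
    (Fin n → {z : ZFSet.{u} // z ∈ ZFSet.vonNeumann α}), witnessBound i.2.1 fun k => (i.2.2 k).1)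

theorem lt_witnessLevel (α : Ordinal.{u}) : α < witnessLevel α :=
  (Order.lt_succ α).trans_le (le_max_left _ _)

theorem witnessBound_le_witnessLevel {α : Ordinal.{u}} {n : ℕ}
    (φ : setLang.BoundedFormula Empty (n + 1)) {a : Fin n → ZFSet.{u}}
    (ha : ∀ i, a i ∈ ZFSet.vonNeumann α) : witnessBound φ a ≤ witnessLevel α :=
  le_max_of_le_right <| Ordinal.le_iSup (fun i : Σ n : ℕ, setLang.BoundedFormula Empty (n + 1) ×
    (Fin n → {z : ZFSet.{u} // z ∈ ZFSet.vonNeumann α}) =>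
      witnessBound i.2.1 fun k => (i.2.2 k).1) ⟨n, φ, fun k => ⟨a k, ha k⟩⟩

/-- Close off under witnesses `ω` times. Finitely many parameters appear at one stage and receive a
witness at the next, so the Tarski–Vaught test makes `V_κ` elementary in `V` for all formulas. -/
theorem exists_sigmaOneCorrect (o : Ordinal.{u}) :
    ∃ κ : Ordinal.{u}, o < κ ∧ SigmaOneCorrect κ := by
  -- Starting with one application of `witnessLevel` makes `o < s 0`, hence `o < κ`.
  let s : ℕ → Ordinal.{u} := fun n => witnessLevel^[n + 1] o
  have hs_succ : ∀ n, s (n + 1) = witnessLevel (s n) := fun n =>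
    Function.iterate_succ_apply' _ _ _
  have hs : Monotone s := monotone_nat_of_le_succ fun n => by
    rw [hs_succ]
    exact (lt_witnessLevel _).le
  let κ : Ordinal.{u} := ⨆ n, s n
  have hle : ∀ n, s n ≤ κ := Ordinal.le_iSup s
  refine ⟨κ, (lt_witnessLevel o).trans_le (hle 0), ?_⟩
  let f : {x : ZFSet.{u} // x ∈ ZFSet.vonNeumann κ} ↪[setLang] ZFSet.{u} :=
    { toFun := Subtype.val
      inj' := Subtype.val_injective
      map_fun' := fun g => nomatch g
      map_rel' := fun r xs => by cases r; exact Iff.rfl }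
  intro n φ _ a
  refine (f.isElementary_of_exists (fun n φ x a ha => ?_) φ a).symm
  have hx : ∀ i, ∃ m, (x i).1.rank < s m := fun i =>
    Ordinal.lt_iSup_iff.1 (ZFSet.mem_vonNeumann.1 (x i).2)
  choose m hm using hx
  have hx' : ∀ i, (x i).1 ∈ ZFSet.vonNeumann (s (Finset.univ.sup m)) := fun i =>
    ZFSet.mem_vonNeumann.2 ((hm i).trans_le (hs (Finset.le_sup (Finset.mem_univ i))))
  obtain ⟨z, hz, hφ⟩ := exists_mem_vonNeumann_witnessBound (a := f ∘ x) ⟨a, ha⟩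
  have h := witnessBound_le_witnessLevel φ hx'
  rw [← hs_succ] at h
  exact ⟨⟨z, ZFSet.vonNeumann_subset_of_le (h.trans (hle _)) hz⟩, hφ⟩

/-! ### Functions as sets -/

theorem IsTransitiveClass.of_pair {P : ZFSet.{u} → Prop} (hP : IsTransitiveClass P)
    {a b : ZFSet.{u}} (h : P (ZFSet.pair a b)) : P a ∧ P b := by
  have h' : P {a, b} := hP _ h _ (by simp [ZFSet.pair])
  exact ⟨hP _ h' _ (by simp), hP _ h' _ (by simp)⟩

theorem pair_app_mem {f a : ZFSet.{u}} (ha : a ∈ dom f) : ZFSet.pair a (app f a) ∈ f := by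
  have h := mem_dom.1 ha
  rw [app, dif_pos h]
  exact h.choose_spec

theorem IsFunction.app_eq {f a b : ZFSet.{u}} (hf : IsFunction f) (h : ZFSet.pair a b ∈ f) :
    app f a = b :=
  hf.2 _ _ _ (pair_app_mem (mem_dom.2 ⟨b, h⟩)) h

theorem IsTransitiveClass.mem_dom {P : ZFSet.{u} → Prop} (hP : IsTransitiveClass P)
    {f a : ZFSet.{u}} (hf : P f) (ha : a ∈ dom f) : P a ∧ P (app f a) :=
  hP.of_pair (hP _ hf _ (pair_app_mem ha))

theorem pair_mem_tuple {n : ZFSet.{u}} (t : {i : ZFSet.{u} // i ∈ n} → ZFSet.{u})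
    (i : {i : ZFSet.{u} // i ∈ n}) : ZFSet.pair i.1 (t i) ∈ tuple t :=
  ZFSet.mem_range_self (f := fun i : {i : ZFSet.{u} // i ∈ n} => ZFSet.pair i.1 (t i)) i

theorem IsFunction.eq_tuple {f n : ZFSet.{u}} (hf : IsFunction f) (hn : dom f = n)
    (t : {i : ZFSet.{u} // i ∈ n} → ZFSet.{u}) (h : ∀ i, ZFSet.pair i.1 (t i) ∈ f) :
    f = tuple t := by
  ext p
  constructor
  · intro hp
    obtain ⟨a, b, rfl⟩ := hf.1 p hp
    have ha : a ∈ n := hn ▸ mem_dom.2 ⟨b, hp⟩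
    rw [hf.2 _ _ _ hp (h ⟨a, ha⟩)]
    exact pair_mem_tuple t ⟨a, ha⟩
  · intro hp
    obtain ⟨i, rfl⟩ := ZFSet.mem_range.1 hp
    exact h i

/-! ### Product reflection -/

theorem mem_cut {C : Set ZFSet.{u}} {κ : Ordinal.{u}} {x : ZFSet.{u}} :
    x ∈ cut C κ ↔ x ∈ ZFSet.vonNeumann κ ∧ x ∈ C :=
  ZFSet.mem_sep

/-- The homomorphism evaluates a choice function at the reflected graph `B` and then applies `j`. -/
theorem SigmaOneCorrect.graphWitness {κ : Ordinal.{u}} (hκ : SigmaOneCorrect κ)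
    {C : Set ZFSet.{u}} (hC : SigmaOneDefinable {x | x ∈ ZFSet.vonNeumann κ} C)
    (hG : IsGraphClass C) : GraphWitness C (cut C κ) := by
  refine ⟨fun x hx => (mem_cut.1 hx).2, fun A hA => ?_⟩
  -- No fixed points of `j` are needed for graphs, so `ω` is just some ordinal below `κ`.
  obtain ⟨y, hyC, hyκ, M, j, hM, hyM, hjy, -, hj, hpair⟩ := hC.exists_reflection hκ hκ.omega0_lt hA
  obtain ⟨B, rfl⟩ := hG y hyC
  obtain ⟨hG, hE⟩ := hM.of_pair hyM
  rw [Graph.code, hpair _ hG _ hE, Graph.code, ZFSet.pair_inj] at hjy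
  let i : GraphIn (cut C κ) := ⟨B, mem_cut.2 ⟨hyκ, hyC⟩⟩
  have hmem : ∀ x : {x : ZFSet.{u} // x ∈ B.G}, x.1 ∈ M := fun x => hM _ hG _ x.2
  refine ⟨⟨fun f => ⟨j (f i).1, hjy.1 ▸ hj _ (hmem (f i)) _ hG (f i).2⟩, fun {f g} h => ?_⟩⟩
  change ZFSet.pair (j (f i).1) (j (g i).1) ∈ A.E
  rw [← hjy.2, ← hpair _ (hmem (f i)) _ (hmem (g i))]
  exact hj _ (hM _ hE _ (h i)) _ hE (h i)

theorem SigmaOneCorrect.strWitness {κ : Ordinal.{u}} (hκ : SigmaOneCorrect κ)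
    {τ : RelLang.{u}} (hτ : τ.code ∈ ZFSet.vonNeumann κ)
    {C : Set ZFSet.{u}} (hC : SigmaOneDefinable {x | x ∈ ZFSet.vonNeumann κ} C)
    (hS : IsStrClass τ C) : StrWitness τ C (cut C κ) := by
  refine ⟨fun x hx => (mem_cut.1 hx).2, fun A hA => ?_⟩
  -- With `β` the successor of the rank of `τ.code`, `j` fixes every sort, symbol and argument
  -- place.
  obtain ⟨y, hyC, hyκ, M, j, hM, hyM, hjy, hid, hj, hpair⟩ :=
    hC.exists_reflection hκ (hκ.succ_lt (ZFSet.mem_vonNeumann.1 hτ)) hA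
  obtain ⟨B, rfl⟩ := hS y hyC
  obtain ⟨hU, hR⟩ := hM.of_pair hyM
  rw [Str.code, hpair _ hU _ hR, Str.code, ZFSet.pair_inj] at hjy
  have hV : IsTransitiveClass (· ∈ ZFSet.vonNeumann (Order.succ τ.code.rank)) :=
    fun x hx y hy => (ZFSet.isTransitive_vonNeumann _).mem_trans hy hx
  obtain ⟨hsorts, htype⟩ := hV.of_pair (ZFSet.mem_vonNeumann_succ τ.code)
  -- `j` commutes with evaluation at a fixed argument, because it preserves the pair `⟨a, f(a)⟩ ∈
  -- f`.
  have happ : ∀ f ∈ M, ∀ a ∈ dom f, j a = a → IsFunction (j f) →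
      app f a ∈ M ∧ app (j f) a = j (app f a) := by
    intro f hf a ha hja hjf
    obtain ⟨haM, hM'⟩ := hM.mem_dom (P := (· ∈ M)) hf ha
    have h := pair_app_mem ha
    refine ⟨hM', hjf.app_eq ?_⟩
    have h' := hj _ (hM _ hf _ h) _ hf h
    rwa [hpair _ haM _ hM', hja] at h'
  have huniv : ∀ s ∈ τ.sorts, app B.univ s ∈ M ∧ app A.univ s = j (app B.univ s) := by
    intro s hs
    rw [← hjy.1]
    refine happ _ hU s (B.dom_univ ▸ hs) (hid s (hV _ hsorts _ hs)).2 ?_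
    rw [hjy.1]
    exact A.isFunction_univ
  have hrel : ∀ R ∈ dom τ.type, app B.rel R ∈ M ∧ app A.rel R = j (app B.rel R) := by
    intro R hR'
    rw [← hjy.2]
    refine happ _ hR R (B.dom_rel ▸ hR') (hid R (hV.mem_dom htype hR').1).2 ?_
    rw [hjy.2]
    exact A.isFunction_rel
  let b : {A : Str τ // A.code ∈ cut C κ} := ⟨B, mem_cut.2 ⟨hyκ, hyC⟩⟩
  refine ⟨⟨fun s f => ⟨j (f b).1, ?_⟩, fun R t ht => ?_⟩⟩
  · obtain ⟨h, h'⟩ := huniv s.1 s.2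
    rw [h']
    exact hj _ (hM _ h _ (f b).2) _ h (f b).2
  · obtain ⟨h, h'⟩ := hrel R.1 R.2
    change tuple (fun i : τ.Places R => j (t i b).1) ∈ app A.rel R.1
    have hT : tuple (fun i : τ.Places R => (t i b).1) ∈ app B.rel R.1 := ht b
    have hTM := hM _ h _ hT
    have hjT := hj _ hTM _ h hT
    rw [← h'] at hjT
    -- For infinite arities `j` might add entries to a sequence. Membership in a relation of `A`
    -- forces the domain to be the arity, so the image is exactly the sequence of the `j`-images.
    obtain ⟨hfun, hdom, -⟩ := A.isFunction_of_mem R.1 R.2 _ hjT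
    rwa [← hfun.eq_tuple hdom fun i : τ.Places R => j (t i b).1]
    intro i
    have hi := pair_mem_tuple (fun i : τ.Places R => (t i b).1) i
    have hiM := hM _ hTM _ hi
    have h'' := hj _ hiM _ hTM hi
    obtain ⟨h₁, h₂⟩ := hM.of_pair hiM
    rwa [hpair _ h₁ _ h₂, (hid i.1 (hV.mem_dom (hV.mem_dom htype R.2).2 i.2).1).2] at h''

/-- Only finitely many parameters occur, so some Σ₁-correct `κ` exceeds all their ranks. -/
theorem boldfaceSigmaOnePRP : BoldfaceSigmaOnePRP.{u} := by
  rintro C ⟨n, φ, p, hφ, -, hC⟩ - hG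
  obtain ⟨κ, hpκ, hκ⟩ := exists_sigmaOneCorrect (Finset.univ.sup fun i => (p i).rank)
  refine ⟨cut C κ, hκ.graphWitness ⟨n, φ, p, hφ, fun i => ?_, hC⟩ hG⟩
  exact ZFSet.mem_vonNeumann.2
    ((Finset.le_sup (f := fun i => (p i).rank) (Finset.mem_univ i)).trans_lt hpκ)

end

end PRP

theorem mainTheorem12 :
    PRP.BoldfaceSigmaOnePRP.{u} ∧
    ∀ κ : Ordinal.{u}, PRP.SigmaOneCorrect κ →
      (∀ C : Set ZFSet.{u},
        PRP.SigmaOneDefinable {x | x ∈ ZFSet.vonNeumann κ} C →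
        PRP.IsProperClass C → PRP.IsGraphClass C →
        PRP.GraphWitness C (PRP.cut C κ)) ∧
      (∀ τ : PRP.RelLang.{u}, τ.code ∈ ZFSet.vonNeumann κ →
        ∀ C : Set ZFSet.{u},
          PRP.SigmaOneDefinable {x | x ∈ ZFSet.vonNeumann κ} C →
          PRP.IsProperClass C → PRP.IsStrClass τ C →
          PRP.StrWitness τ C (PRP.cut C κ)) :=
  ⟨PRP.boldfaceSigmaOnePRP, fun _ hκ => ⟨fun _ hC _ hG => hκ.graphWitness hC hG,
    fun _ hτ _ hC _ hS => hκ.strWitness hτ hC hS⟩⟩
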